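/- Let $M_n$ be the space of complex $n\times n$ matrices, and for $A\in M_n$ let $\sigma(A)\subset\mathbb{C}$ be its set of eigenvalues. A set $S\subseteq M_n$ has *uniform multiplicity* if all matrices in $S$ have the same multiplicity list, i.e. for all $A,B\in S$ and every $k$, the number of distinct eigenvalues of algebraic multiplicity $k$ is the same for $A$ and for $B$. An *eigenpath* of $P:[0,1]\to M_n$ is a continuous function $e:[0,1]\to\mathbb{C}$ with $e(t)\in\sigma(P(t))$ for all $t$; we write $\lambda\rightsquigarrow_{P}\mu$ if $P$ has an eigenpath $e$ with $e(0)=\lambda$ and $e(1)=\mu$. Let $S\subseteq M_n$, let $A_1,A_2:[0,1]\to S$ be closed (continuous) paths, and let $A:[0,1]\times[0,1]\to M_n$ be a deformation of $A_1$ and $A_2$ in $S$: $A$ is continuous, $A(x,0)=A_1(x)$ and $A(x,1)=A_2(x)$ for all $x$, and for every fixed $y$ the path $x\mapsto A(x,y)$ is a closed path in $S$. Let $\lambda_i(0,0),\lambda_j(1,0),\lambda_i(0,1),\lambda_j(1,1)\in\mathbb{C}$ be such that $$\lambda_i(0,0)\rightsquigarrow_{A(\cdot,0)}\lambda_j(1,0),\qquad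 \lambda_i(0,0)\rightsquigarrow_{A(0,\cdot)}\lambda_i(0,1),\qquad \lambda_j(1,0)\rightsquigarrow_{A(1,\cdot)}\lambda_j(1,1),$$ but $$\lambda_i(0,1)\not\rightsquigarrow_{A(\cdot,1)}\lambda_j(1,1).$$ Then the image $\{A(x,y): x,y\in[0,1]\}$ does not have uniform multiplicity. -/

import Mathlib

open scoped unitInterval

namespace EigenPairing

/-- The number `a_k` of distinct eigenvalues of `A` whose algebraic multiplicity (as a root of the
characteristic polynomial) is `k`. The function `k ↦ multCount A k` is the multiplicity list
of `A`. -/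
noncomputable def multCount {n : ℕ} (A : Matrix (Fin n) (Fin n) ℂ) (k : ℕ) : ℕ :=
  {μ : ℂ | μ ∈ spectrum ℂ A ∧ A.charpoly.rootMultiplicity μ = k}.ncard

/-- `S` has uniform multiplicity: eigenvalues of a given algebraic multiplicity occur equally often
in any two members of `S`, that is, all members of `S` have the same multiplicity list. -/
def HasUniformMultiplicity {n : ℕ} (S : Set (Matrix (Fin n) (Fin n) ℂ)) : Prop :=
  ∀ A ∈ S, ∀ B ∈ S, ∀ k : ℕ, multCount A k = multCount B k

/-- `e` is an eigenpath of the matrix path `P`: a continuous choice of an eigenvalue of `P t`. -/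
def IsEigenpath {n : ℕ} (P : I → Matrix (Fin n) (Fin n) ℂ) (e : I → ℂ) : Prop :=
  Continuous e ∧ ∀ t : I, e t ∈ spectrum ℂ (P t)

/-- The path `P` pairs `a` with `b`: some eigenpath of `P` starts at `a` and ends at `b`. -/
def PairedAlong {n : ℕ} (P : I → Matrix (Fin n) (Fin n) ℂ) (a b : ℂ) : Prop :=
  ∃ e : I → ℂ, IsEigenpath P e ∧ e 0 = a ∧ e 1 = b

/-- `P` is a closed path in `S`. -/
structure IsClosedPath {n : ℕ} (S : Set (Matrix (Fin n) (Fin n) ℂ))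
    (P : I → Matrix (Fin n) (Fin n) ℂ) : Prop where
  continuous : Continuous P
  mem : ∀ x : I, P x ∈ S
  closed : P 0 = P 1

/-- `A` is a deformation in `S` of the path `A₁` into the path `A₂`: it is jointly continuous on the
unit square, `A (x, 0) = A₁ x`, `A (x, 1) = A₂ x`, and `x ↦ A (x, y)` is a closed path in `S` for
every `y`. -/
structure IsDeformation {n : ℕ} (S : Set (Matrix (Fin n) (Fin n) ℂ))
    (A₁ A₂ : I → Matrix (Fin n) (Fin n) ℂ) (A : I × I → Matrix (Fin n) (Fin n) ℂ) : Prop where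
  continuous : Continuous A
  bottom : ∀ x : I, A (x, 0) = A₁ x
  top : ∀ x : I, A (x, 1) = A₂ x
  closedPath : ∀ y : I, IsClosedPath S (fun x => A (x, y))

end EigenPairing

open scoped Topology

namespace EigenPairing

/-! Contrapositive: uniform multiplicity fixes the number of distinct eigenvalues, so they can
neither split nor merge, and the pairs (point, eigenvalue) form a covering of the square
(`isCoveringMap_spectrum`). Lifting the square from the bottom eigenpath, uniqueness of lifts makes
its vertical sides the given eigenpaths, so its top side pairs the top corners. For the covering it
suffices that eigenvalues persist nearby; constant cardinality excludes any others. -/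

/-- A monic complex polynomial all of whose roots have distance at least `ε` from `μ` is at least
`ε ^ natDegree` in absolute value at `μ`. -/
theorem pow_natDegree_le_norm_eval {p : Polynomial ℂ} (hp : p.Monic) {μ : ℂ} {ε : ℝ} (hε : 0 ≤ ε)
    (h : ∀ ν ∈ p.roots, ε ≤ dist ν μ) : ε ^ p.natDegree ≤ ‖p.eval μ‖ := by
  have hs := IsAlgClosed.splits p
  have key : ∀ m : Multiset ℂ, (∀ ν ∈ m, ε ≤ dist ν μ) →
      ε ^ m.card ≤ ‖(m.map fun ν => μ - ν).prod‖ := by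
    intro m
    induction m using Multiset.induction_on with
    | empty => simp
    | cons a m ih =>
      intro hm
      rw [Multiset.card_cons, Multiset.map_cons, Multiset.prod_cons, norm_mul, pow_succ']
      have ha : ε ≤ ‖μ - a‖ := by
        rw [← dist_eq_norm, dist_comm]; exact hm a (Multiset.mem_cons_self a m)
      exact mul_le_mul ha (ih fun ν hν => hm ν (Multiset.mem_cons_of_mem hν))
        (pow_nonneg hε _) (norm_nonneg _)
  have := key p.roots h
  rwa [← hs.natDegree_eq_card_roots, ← hs.eval_eq_prod_roots_of_monic hp] at this

/-- Eigenvalues of a continuous family of matrices persist under small perturbations. -/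
theorem eventually_exists_mem_spectrum_dist_lt {n : ℕ} {X : Type*} [TopologicalSpace X]
    {A : X → Matrix (Fin n) (Fin n) ℂ} (hA : Continuous A) {x : X} {μ : ℂ}
    (hμ : μ ∈ spectrum ℂ (A x)) {ε : ℝ} (hε : 0 < ε) :
    ∀ᶠ y in 𝓝 x, ∃ ν ∈ spectrum ℂ (A y), dist ν μ < ε := by
  have hcont : Continuous fun y => ‖(A y).charpoly.eval μ‖ := by
    simp only [Matrix.eval_charpoly]
    fun_prop
  have h0 : ‖(A x).charpoly.eval μ‖ = 0 := by
    rw [(Matrix.mem_spectrum_iff_isRoot_charpoly.mp hμ).eq_zero, norm_zero]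
  have hlt : ∀ᶠ y in 𝓝 x, ‖(A y).charpoly.eval μ‖ < ε ^ n :=
    hcont.continuousAt.eventually (gt_mem_nhds (h0.trans_lt (pow_pos hε n)))
  filter_upwards [hlt] with y hy
  by_contra! hcon
  refine hy.not_ge ?_
  have := pow_natDegree_le_norm_eval (Matrix.charpoly_monic (A y)) (μ := μ) hε.le fun ν hν =>
    hcon ν (Matrix.mem_spectrum_iff_isRoot_charpoly.mpr (Polynomial.isRoot_of_mem_roots hν))
  simpa [Matrix.charpoly_natDegree_eq_dim] using this

/-- The incidence projection of a lower hemicontinuous family of finite sets of constant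
cardinality in a metric space is a covering map. -/
theorem isCoveringMap_fst_of_ncard_eq {X M : Type*} [TopologicalSpace X] [MetricSpace M]
    {Φ : X → Set M} (hfin : ∀ x, (Φ x).Finite) (hcard : ∀ x y, (Φ x).ncard = (Φ y).ncard)
    (hΦ : ∀ x, ∀ μ ∈ Φ x, ∀ ε > 0, ∀ᶠ y in 𝓝 x, ∃ ν ∈ Φ y, dist ν μ < ε) :
    IsCoveringMap fun q : {q : X × M // q.2 ∈ Φ q.1} => q.1.1 := by
  intro x₀
  have (x : X) : Finite (Φ x) := hfin x
  obtain ⟨r, hr, hsep⟩ : ∃ r > 0, ∀ l ∈ Φ x₀, ∀ l' ∈ Φ x₀, dist l l' < 2 * r → l = l' := by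
    obtain ⟨C, hC, h⟩ := (hfin x₀).relatively_discrete
    -- The separation `C` may be `⊤` (at most one point), so pass to a finite `d` below it.
    obtain ⟨d, hd, hdC⟩ := ENNReal.lt_iff_exists_nnreal_btwn.mp hC
    refine ⟨d / 2, half_pos (by exact_mod_cast hd), fun l hl l' hl' hll' => ?_⟩
    by_contra hne
    refine (h l hl l' hl' hne).not_gt (lt_trans ?_ hdC)
    rw [edist_nndist, ENNReal.coe_lt_coe, ← NNReal.coe_lt_coe, coe_nndist]
    linarith
  have hev : ∀ᶠ y in 𝓝 x₀, ∀ l : Φ x₀, ∃ ν ∈ Φ y, dist ν l.1 < r :=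
    Filter.eventually_all.mpr fun l => hΦ x₀ l l.2 r hr
  obtain ⟨U, hU, hUo, hxU⟩ := eventually_nhds_iff.mp hev
  choose s hs hsr using fun y : U => hU y y.2
  have hinj (y : U) : Function.Injective fun l => (⟨s y l, hs y l⟩ : Φ y.1) := by
    intro l l' h
    have h' : s y l = s y l' := congrArg Subtype.val h
    refine Subtype.ext (hsep l l.2 l' l'.2 ?_)
    have h₁ := hsr y l
    have h₂ := hsr y l'
    rw [← h'] at h₂
    linarith [dist_triangle_left l.1 l'.1 (s y l)]
  have hsurj (y : U) : ∀ ν ∈ Φ y.1, ∃ l, s y l = ν := by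
    intro ν hν
    -- Equal finite cardinality turns the injection of fibres into a bijection.
    obtain ⟨l, hl⟩ := ((Nat.bijective_iff_injective_and_card _).mpr
      ⟨hinj y, (hcard x₀ y.1 :)⟩).surjective ⟨ν, hν⟩
    exact ⟨l, congrArg Subtype.val hl⟩
  have huniq (y : U) (l : Φ x₀) (ν : M) (hν : ν ∈ Φ y.1) (hd : dist ν l.1 < r) : s y l = ν := by
    obtain ⟨l', rfl⟩ := hsurj y ν hν
    have : l.1 = l'.1 := hsep l l.2 l' l'.2 (by
      linarith [dist_triangle_left l.1 l'.1 (s y l'), hsr y l'])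
    rw [Subtype.ext this]
  have hscont (l : Φ x₀) : Continuous fun y : U => s y l := by
    rw [continuous_iff_continuousAt]
    intro y
    rw [ContinuousAt, Metric.tendsto_nhds]
    intro ε hε
    -- The second bound keeps `ν` within `r` of `l`, so `huniq` places it on the sheet of `l`.
    have h := hΦ y.1 (s y l) (hs y l) (min ε (r - dist (s y l) l.1))
      (lt_min hε (sub_pos.mpr (hsr y l)))
    filter_upwards [continuous_subtype_val.continuousAt.eventually h] with z ⟨ν, hν, hd⟩
    have hd₁ := hd.trans_le (min_le_left _ _)
    have hd₂ := hd.trans_le (min_le_right _ _)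
    rw [huniq z l ν hν (by linarith [dist_triangle ν (s y l) l.1])]
    exact hd₁
  let f := fun q : {q : X × M // q.2 ∈ Φ q.1} => q.1.1
  have hf : Continuous f := by fun_prop
  let G : U × Φ x₀ → f ⁻¹' U := fun p => ⟨⟨(p.1.1, s p.1 p.2), hs p.1 p.2⟩, p.1.2⟩
  have hG : Function.Bijective G := by
    constructor
    · rintro ⟨y, l⟩ ⟨y', l'⟩ h
      have h₁ : y = y' := Subtype.ext (congrArg (fun q => q.1.1.1) h)
      subst h₁
      have h₂ : s y l = s y l' := congrArg (fun q => q.1.1.2) h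
      rw [hinj y (Subtype.ext h₂)]
    · rintro ⟨⟨⟨y, ν⟩, hν⟩, hy⟩
      obtain ⟨l, hl⟩ := hsurj ⟨y, hy⟩ ν hν
      exact ⟨(⟨y, hy⟩, l), Subtype.ext (Subtype.ext (Prod.ext rfl hl))⟩
  let e := Equiv.ofBijective G hG
  have he (q : f ⁻¹' U) : G (e.symm q) = q := e.apply_symm_apply q
  have he₁ (q : f ⁻¹' U) : (e.symm q).1.1 = q.1.1.1 := congrArg (fun q => q.1.1.1) (he q)
  have he₂ (q : f ⁻¹' U) : s (e.symm q).1 (e.symm q).2 = q.1.1.2 :=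
    congrArg (fun q => q.1.1.2) (he q)
  suffices IsEvenlyCovered f x₀ (Φ x₀) from this.to_isEvenlyCovered_preimage
  refine ⟨inferInstance, U, hxU, hUo, hUo.preimage hf, ⟨e.symm, ?_, ?_⟩, he₁⟩
  · refine Continuous.prodMk ?_ ?_
    · refine continuous_induced_rng.mpr ?_
      exact (hf.comp continuous_subtype_val).congr fun q => (he₁ q).symm
    · rw [continuous_discrete_rng]
      intro l
      -- The sheet index is locally constant: sheet `l` is cut out by the open condition of lying
      -- within `r` of `l`.
      have : (fun q : f ⁻¹' U => (e.symm q).2) ⁻¹' {l} =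
          (fun q : f ⁻¹' U => dist q.1.1.2 l.1) ⁻¹' Set.Iio r := by
        ext q
        simp only [Set.mem_preimage, Set.mem_singleton_iff, Set.mem_Iio]
        constructor
        · rintro rfl
          rw [← he₂ q]
          exact hsr _ _
        · intro hd
          have hmem : q.1.1.2 ∈ Φ (e.symm q).1.1 := by rw [he₁ q]; exact q.1.2
          have := huniq (e.symm q).1 l _ hmem hd
          exact hinj (e.symm q).1 (Subtype.ext ((he₂ q).trans this.symm))
      have hopen : IsOpen ((fun q : f ⁻¹' U => (e.symm q).2) ⁻¹' {l}) := by
        rw [this]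
        exact isOpen_Iio.preimage (by fun_prop)
      exact hopen
  · refine Continuous.subtype_mk (Continuous.subtype_mk (Continuous.prodMk (by fun_prop) ?_) _) _
    exact continuous_prod_of_discrete_right.mpr hscont

/-- The number of distinct eigenvalues is the sum of the multiplicity list. -/
theorem ncard_spectrum_eq_sum_multCount {n : ℕ} (A : Matrix (Fin n) (Fin n) ℂ) :
    (spectrum ℂ A).ncard = ∑ k ∈ Finset.range (n + 1), multCount A k := by
  classical
  have hfin := Matrix.finite_spectrum A
  rw [Set.ncard_eq_toFinset_card _ hfin, Finset.card_eq_sum_card_fiberwise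
    (f := fun μ => A.charpoly.rootMultiplicity μ) (t := Finset.range (n + 1))]
  · refine Finset.sum_congr rfl fun k _ => ?_
    rw [multCount, ← Set.ncard_coe_finset]
    congr 1
    ext μ
    simp
  · intro μ _
    have h : A.charpoly.rootMultiplicity μ ≤ A.charpoly.natDegree := by
      rw [← Polynomial.count_roots]
      exact (Multiset.count_le_card _ _).trans (Polynomial.card_roots' _)
    rw [Matrix.charpoly_natDegree_eq_dim, Fintype.card_fin] at h
    simpa [Nat.lt_succ_iff] using h

/-- The eigenvalues of a continuous family with uniform multiplicity form a covering space. -/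
theorem isCoveringMap_spectrum {n : ℕ} {X : Type*} [TopologicalSpace X]
    {A : X → Matrix (Fin n) (Fin n) ℂ} (hA : Continuous A)
    (hU : HasUniformMultiplicity (Set.range A)) :
    IsCoveringMap fun q : {q : X × ℂ // q.2 ∈ spectrum ℂ (A q.1)} => q.1.1 := by
  refine isCoveringMap_fst_of_ncard_eq (Φ := fun x => spectrum ℂ (A x))
    (fun x => Matrix.finite_spectrum (A x)) (fun x y => ?_)
    fun x μ hμ ε hε => eventually_exists_mem_spectrum_dist_lt hA hμ hε
  rw [ncard_spectrum_eq_sum_multCount, ncard_spectrum_eq_sum_multCount]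
  exact Finset.sum_congr rfl fun k _ => hU _ ⟨x, rfl⟩ _ ⟨y, rfl⟩ k

/-- In a family over the square with uniform multiplicity, a pairing along the bottom edge is
transported along the vertical edges to a pairing along the top edge. -/
theorem PairedAlong.transport {n : ℕ} {A : I × I → Matrix (Fin n) (Fin n) ℂ} (hA : Continuous A)
    (hU : HasUniformMultiplicity (Set.range A)) {a0 b0 a1 b1 : ℂ}
    (hbottom : PairedAlong (fun x => A (x, 0)) a0 b0)
    (hleft : PairedAlong (fun y => A (0, y)) a0 a1)
    (hright : PairedAlong (fun y => A (1, y)) b0 b1) :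
    PairedAlong (fun x => A (x, 1)) a1 b1 := by
  have cov := isCoveringMap_spectrum hA hU
  obtain ⟨e, ⟨hec, hes⟩, rfl, rfl⟩ := hbottom
  let F : C(I, {q : (I × I) × ℂ // q.2 ∈ spectrum ℂ (A q.1)}) :=
    ⟨fun x => ⟨((x, 0), e x), hes x⟩, by fun_prop⟩
  -- Homotopy time is the first coordinate of `H`; the swap makes it the vertical direction.
  let H : C(I × I, I × I) := ContinuousMap.prodSwap
  let L := cov.liftHomotopy H F fun _ => rfl
  have hL (y x : I) : (L (y, x)).1.1 = (x, y) :=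
    congrFun (cov.liftHomotopy_lifts H F fun _ => rfl) (y, x)
  have hL0 (x : I) : L (0, x) = F x := cov.liftHomotopy_zero H F (fun _ => rfl) x
  have hedge (x : I) (c : ℂ) (h : PairedAlong (fun y => A (x, y)) (e x) c) :
      (L (1, x)).1.2 = c := by
    obtain ⟨g, ⟨hgc, hgs⟩, hg0, rfl⟩ := h
    let Γ : I → {q : (I × I) × ℂ // q.2 ∈ spectrum ℂ (A q.1)} := fun y => ⟨((x, y), g y), hgs y⟩
    have heq : (fun y => L (y, x)) = Γ := by
      refine cov.eq_of_comp_eq (by fun_prop) (by fun_prop) (funext fun y => hL y x) 0 ?_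
      rw [hL0]
      exact Subtype.ext (Prod.ext rfl hg0.symm)
    exact congrArg (fun q => q.1.2) (congrFun heq 1)
  refine ⟨fun x => (L (1, x)).1.2, ⟨by fun_prop, fun x => ?_⟩, hedge 0 _ hleft, hedge 1 _ hright⟩
  have := (L (1, x)).2
  rwa [hL] at this

end EigenPairing

theorem mainTheorem1 {n : ℕ} (S : Set (Matrix (Fin n) (Fin n) ℂ))
    (A₁ A₂ : unitInterval → Matrix (Fin n) (Fin n) ℂ)
    (hA₁ : EigenPairing.IsClosedPath S A₁) (hA₂ : EigenPairing.IsClosedPath S A₂)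
    (A : unitInterval × unitInterval → Matrix (Fin n) (Fin n) ℂ)
    (hA : EigenPairing.IsDeformation S A₁ A₂ A)
    -- `a0`, `b0`, `a1`, `b1` are values at the corners `(0, 0)`, `(1, 0)`, `(0, 1)`, `(1, 1)`
    (a0 b0 a1 b1 : ℂ)
    (hbottom : EigenPairing.PairedAlong (fun x => A (x, 0)) a0 b0)
    (hleft : EigenPairing.PairedAlong (fun y => A (0, y)) a0 a1)
    (hright : EigenPairing.PairedAlong (fun y => A (1, y)) b0 b1)
    (htop : ¬ EigenPairing.PairedAlong (fun x => A (x, 1)) a1 b1) :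
    ¬ EigenPairing.HasUniformMultiplicity (Set.range A) := by
  exact fun hU => htop (hbottom.transport hA.continuous hU hleft hright)
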